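/- Let $k$ be a field, $n\ge 1$ and $d\ge 2n-1$ integers, and let $F\in k[z_1,\dots,z_{n+1}]$ be a form of degree $d$, i.e. a global section of $\mathcal O_{\mathbb P^n}(d)$. **Flag variety and coordinates.** Let $\Phi=\{(L,p): p\in L\}$ be the variety of pointed lines in $\mathbb P^n_k$, with projections $\pi:\Phi\to G=\mathbb G\mathrm r(1,n)$ and $\beta:\Phi\to\mathbb P^n$. For $I=\{i_1<i_2\}\subset\{1,\dots,n+1\}$ with complement $c_1<\dots<c_{n-1}$ and $\ell\in\{1,2\}$ (with $\ell'$ the other index), let $U_{I,\ell}\cong\mathbb A^{2n-1}$ be the standard chart of $\Phi$ with coordinates $(x_{1,1},x_{2,1},\dots,x_{1,n-1},x_{2,n-1},y)$, in this order. Put $\tilde e_s=e_{i_s}+\sum_j x_{s,j}e_{c_j}$ and $t=t_{I,\ell}=(-1)^{\ell-1}y$. The point with these coordinates is the line $L=\mathrm{span}(\tilde e_1,\tilde e_2)$ with the marked point $p=\mathrm{span}(v)$, where $v=\tilde e_\ell+t\,\tilde e_{\ell'}$. Thus $t$ is the affine coordinate $z_{i_{\ell'}}/z_{i_\ell}$ on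 the lines, and $t-t(p)$ is a local parameter of $L$ at $p$. On $U_{I,\ell}$ trivialize $\mathcal O_\Phi(d)=\beta^*\mathcal O_{\mathbb P^n}(d)$ by $z_{i_\ell}^d$, so that $\beta^*F=F(v)\in k[x_{s,j},y]$. **Section.** Let $\mathcal E_{2n-1}=\mathcal P^{2n-2}_{\Phi/G}(\mathcal O_\Phi(d))$ be the bundle of relative principal parts, of rank $2n-1=\dim\Phi$, and let $\sigma_F$ be its section given by the principal parts of $\beta^*F$. On $U_{I,\ell}$ the bundle is trivialized by $\tau_{I,\ell}:f\mapsto(f,D^{(1)}_tf,\dots,D^{(2n-2)}_tf)$. Here $D^{(a)}_t$ is the $a$-th Hasse derivative with respect to $t$ (linear over $k[x_{s,j}]$, with $D^{(a)}_tt^N=\binom Na t^{N-a}$). Let $g=g_{I,\ell}=\tau_{I,\ell}\circ\sigma_F:\mathbb A^{2n-1}\to\mathbb A^{2n-1}$ be the resulting map in the coordinates of $U_{I,\ell}$. **Local index.** At an isolated zero of $\sigma_F$ in $U_{I,\ell}$, let $Q$ be the local ring of the zero scheme of $\sigma_F$ there, a finite-dimensional $k$-algebra. The local index of $\sigma_F$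 (in the chart $U_{I,\ell}$ and the trivialization $\tau_{I,\ell}$) is the local degree of $g$, i.e. the class in $GW(k)$ of its Scheja–Storch form. Explicitly, write the coordinates as $u_1,\dots,u_{2n-1}$ and $g_i\otimes1-1\otimes g_i=\sum_j a_{ij}(u_j\otimes 1-1\otimes u_j)$, let $\Delta\in Q\otimes_kQ$ be the image of $\det(a_{ij})$, and let $\eta:Q\to k$ be the linear functional with $(\eta\otimes\mathrm{id})(\Delta)=1$. The form is $(a,b)\mapsto\eta(ab)$ on $Q$. **Theorem.** Let $(L,p)$ be a closed point of $\Phi$ with residue field $k(L,p)$ such that $L$ is tangent to $\mathbb V(F)$ at $p$ to order (at least) $2n-1$, i.e. $(L,p)$ is a zero of $\sigma_F$. Assume that it is an isolated, geometrically reduced point of the zero scheme of $\sigma_F$ in $\Phi$, meaning that the local ring of this zero scheme at $(L,p)$ is finite-dimensional and geometrically reduced over $k$. Assume also that $k(L,p)/k$ is separable. Then for every standard chart $U_{I,\ell}$ containing $(L,p)$, with $t=t_{I,\ell}$, the Scheja–Storch form defining the local index is nondegenerate, $\mathrm{Wr}_t(\nabla\beta^*F)(p)\neq0$, and in $GW(k)$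 $$\mathrm{ind}_{(L,p)}\sigma_F=\mathrm{Tr}_{k(L,p)/k}\big\langle \mathrm{Wr}_t(\nabla\beta^*F)(p)\big\rangle .$$ Here $\nabla$ is the gradient with respect to the coordinates $(x_{1,1},x_{2,1},\dots,x_{1,n-1},x_{2,n-1},y)$ of $U_{I,\ell}$, restricted to $L$. The Hasse–Wronskian of $f_1,\dots,f_m\in k(L,p)[t]$ is $\mathrm{Wr}_t(f_1,\dots,f_m)=\det\big(D^{(a)}_tf_j\big)_{0\le a<m,\,1\le j\le m}$. Finally, $\mathrm{Tr}_{k(L,p)/k}\langle c\rangle$ is the class of the form $(a,b)\mapsto\mathrm{Tr}_{k(L,p)/k}(cab)$ on $k(L,p)$. -/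

import Mathlib

open scoped TensorProduct Polynomial

universe u

namespace HighlyTangent

noncomputable section

/-! ## The Grothendieck–Witt group -/

/-- A finite dimensional `k`-vector space with a nondegenerate symmetric bilinear form. -/
structure SymmBilinSpace (k : Type u) [Field k] where
  carrier : Type u
  [addCommGroup : AddCommGroup carrier]
  [module : Module k carrier]
  [finiteDimensional : FiniteDimensional k carrier]
  form : LinearMap.BilinForm k carrier
  symm : form.IsSymm
  nondegenerate : form.Nondegenerate

attribute [instance] SymmBilinSpace.addCommGroup SymmBilinSpace.module
  SymmBilinSpace.finiteDimensional

/-- `V` and `W` are isometric. -/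
def Isometric {k : Type u} [Field k] (V W : SymmBilinSpace k) : Prop :=
  ∃ e : V.carrier ≃ₗ[k] W.carrier, ∀ x y, V.form x y = W.form (e x) (e y)

/-- `U` is isometric to the orthogonal direct sum of `V` and `W`. -/
def IsOrthogonalSum {k : Type u} [Field k] (U V W : SymmBilinSpace k) : Prop :=
  ∃ e : U.carrier ≃ₗ[k] V.carrier × W.carrier,
    ∀ x y, U.form x y = V.form (e x).1 (e y).1 + W.form (e x).2 (e y).2

/-- The relations `[V] = [W]` for isometric `V`, `W`, and `[V ⊥ W] = [V] + [W]`. -/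
def gwRelations (k : Type u) [Field k] : Set (FreeAbelianGroup (SymmBilinSpace k)) :=
  {x | ∃ V W, Isometric V W ∧ x = FreeAbelianGroup.of V - FreeAbelianGroup.of W} ∪
  {x | ∃ U V W, IsOrthogonalSum U V W ∧
    x = FreeAbelianGroup.of U - FreeAbelianGroup.of V - FreeAbelianGroup.of W}

/-- (The additive group of) the Grothendieck–Witt ring `GW(k)`: the group completion of the monoid
of isometry classes of nondegenerate symmetric bilinear forms over `k`. -/
abbrev GW (k : Type u) [Field k] : Type (u + 1) :=
  FreeAbelianGroup (SymmBilinSpace k) ⧸ AddSubgroup.closure (gwRelations k)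

open Classical in
/-- The class in `GW(k)` of a nondegenerate symmetric bilinear form on a finite dimensional vector
space (and `0` for any other bilinear form). -/
def gwClass {k : Type u} [Field k] {V : Type u} [AddCommGroup V] [Module k V]
    (B : LinearMap.BilinForm k V) : GW k :=
  if h : FiniteDimensional k V ∧ B.IsSymm ∧ B.Nondegenerate then
    QuotientAddGroup.mk (FreeAbelianGroup.of
      { carrier := V, finiteDimensional := h.1, form := B, symm := h.2.1, nondegenerate := h.2.2 })
  else 0

/-- The symmetric bilinear form `(x, y) ↦ η (x * y)` on a commutative `k`-algebra. -/
def functionalForm {k Q : Type*} [Field k] [CommRing Q] [Algebra k Q] (η : Q →ₗ[k] k) :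
    LinearMap.BilinForm k Q :=
  (LinearMap.mul k Q).compr₂ η

/-- The form `Tr_{κ/k}⟨a⟩`, that is `(x, y) ↦ Tr_{κ/k} (a * x * y)`. -/
def traceForm (k : Type*) {κ : Type*} [Field k] [Field κ] [Algebra k κ] (a : κ) :
    LinearMap.BilinForm k κ :=
  functionalForm (Algebra.trace k κ ∘ₗ LinearMap.mulLeft k a)

/-! ## The local degree of a polynomial map at a closed point -/

section LocalDegree

variable {k : Type u} [Field k] {m : ℕ}

/-- For every polynomial `f` there are `a_j` with
`f ⊗ 1 - 1 ⊗ f = ∑ j, a_j * (x_j ⊗ 1 - 1 ⊗ x_j)`. -/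
theorem exists_diffQuot (f : MvPolynomial (Fin m) k) :
    ∃ a : Fin m → MvPolynomial (Fin m) k ⊗[k] MvPolynomial (Fin m) k,
      f ⊗ₜ[k] 1 - 1 ⊗ₜ[k] f =
        ∑ j, a j * (MvPolynomial.X j ⊗ₜ[k] 1 - 1 ⊗ₜ[k] MvPolynomial.X j) := by
  classical
  induction f using MvPolynomial.induction_on with
  | C c =>
    refine ⟨0, ?_⟩
    have : (MvPolynomial.C c : MvPolynomial (Fin m) k) = c • 1 := by
      rw [MvPolynomial.smul_eq_C_mul, mul_one]
    simp [this, TensorProduct.smul_tmul]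
  | add f g hf hg =>
    obtain ⟨a, ha⟩ := hf
    obtain ⟨b, hb⟩ := hg
    refine ⟨a + b, ?_⟩
    simp only [Pi.add_apply, add_mul, Finset.sum_add_distrib, ← ha, ← hb,
      TensorProduct.add_tmul, TensorProduct.tmul_add]
    abel
  | mul_X f i hf =>
    obtain ⟨a, ha⟩ := hf
    refine ⟨fun j => a j * (MvPolynomial.X i ⊗ₜ[k] 1) + if j = i then 1 ⊗ₜ[k] f else 0, ?_⟩
    have h1 : ∀ j, (a j * ((MvPolynomial.X i : MvPolynomial (Fin m) k) ⊗ₜ[k] 1) +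
        if j = i then 1 ⊗ₜ[k] f else 0) *
          (MvPolynomial.X j ⊗ₜ[k] 1 - 1 ⊗ₜ[k] MvPolynomial.X j) =
        (a j * (MvPolynomial.X j ⊗ₜ[k] 1 - 1 ⊗ₜ[k] MvPolynomial.X j)) *
          (MvPolynomial.X i ⊗ₜ[k] 1) +
        if j = i then (1 ⊗ₜ[k] f) * (MvPolynomial.X i ⊗ₜ[k] 1 - 1 ⊗ₜ[k] MvPolynomial.X i)
          else 0 := by
      intro j
      split_ifs with h
      · subst h; ring
      · ring
    rw [Finset.sum_congr rfl fun j _ => h1 j, Finset.sum_add_distrib, ← Finset.sum_mul, ← ha,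
      Finset.sum_ite_eq' Finset.univ i, if_pos (Finset.mem_univ i)]
    simp only [sub_mul, mul_sub, Algebra.TensorProduct.tmul_mul_tmul, one_mul, mul_one]
    abel

/-- A choice of difference quotients `a_j` as in `exists_diffQuot`. -/
def diffQuot (f : MvPolynomial (Fin m) k) (j : Fin m) :
    MvPolynomial (Fin m) k ⊗[k] MvPolynomial (Fin m) k :=
  (exists_diffQuot f).choose j

/-- The local ring, at the point `P` of affine space, of the zero scheme of `g : 𝔸ᵐ → 𝔸ᵐ`. -/
def ZeroLocalRing (g : Fin m → MvPolynomial (Fin m) k) (P : Ideal (MvPolynomial (Fin m) k))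
    [P.IsPrime] : Type u :=
  Localization.AtPrime P ⧸ (Ideal.span (Set.range g)).map
    (algebraMap (MvPolynomial (Fin m) k) (Localization.AtPrime P))

variable (g : Fin m → MvPolynomial (Fin m) k) (P : Ideal (MvPolynomial (Fin m) k)) [P.IsPrime]

instance : CommRing (ZeroLocalRing g P) :=
  inferInstanceAs (CommRing (Localization.AtPrime P ⧸ (Ideal.span (Set.range g)).map
    (algebraMap (MvPolynomial (Fin m) k) (Localization.AtPrime P))))

instance : Algebra k (ZeroLocalRing g P) :=
  inferInstanceAs (Algebra k (Localization.AtPrime P ⧸ (Ideal.span (Set.range g)).map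
    (algebraMap (MvPolynomial (Fin m) k) (Localization.AtPrime P))))

/-- The canonical map from polynomials to the local ring of the zero scheme. -/
def toZeroLocalRing : MvPolynomial (Fin m) k →ₐ[k] ZeroLocalRing g P :=
  (Ideal.Quotient.mkₐ k ((Ideal.span (Set.range g)).map
    (algebraMap (MvPolynomial (Fin m) k) (Localization.AtPrime P)))).comp (IsScalarTower.toAlgHom k _ (Localization.AtPrime P))

/-- The Scheja–Storch element `Δ ∈ Q ⊗ Q` of `g` at `P`: the image of the determinant of the
matrix of difference quotients of the `g_i`. It does not depend on the choice of the latter. -/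
def schejaStorchElement : ZeroLocalRing g P ⊗[k] ZeroLocalRing g P :=
  Algebra.TensorProduct.map (toZeroLocalRing g P) (toZeroLocalRing g P)
    (Matrix.det (Matrix.of fun i j => diffQuot (g i) j))

/-- `η` is the Scheja–Storch functional: `(η ⊗ id) Δ = 1`. -/
def IsSchejaStorchFunctional (η : ZeroLocalRing g P →ₗ[k] k) : Prop :=
  TensorProduct.lid k (ZeroLocalRing g P)
    (LinearMap.rTensor (ZeroLocalRing g P) η (schejaStorchElement g P)) = 1

open Classical in
/-- The Scheja–Storch functional at an isolated zero (there it exists and is unique). -/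
def schejaStorchFunctional : ZeroLocalRing g P →ₗ[k] k :=
  if h : ∃ η, IsSchejaStorchFunctional g P η then h.choose else 0

/-- The Scheja–Storch form `(x, y) ↦ η (x * y)` on the local ring of the zero scheme. -/
def schejaStorchForm : LinearMap.BilinForm k (ZeroLocalRing g P) :=
  functionalForm (schejaStorchFunctional g P)

/-- The local (`𝔸¹`-Brouwer) degree of `g : 𝔸ᵐ → 𝔸ᵐ` at the isolated zero `P`, valued in `GW(k)`:
the class of the Scheja–Storch form. -/
def localDegree : GW k := gwClass (schejaStorchForm g P)

end LocalDegree

/-- The point of `𝔸ᵐ` underlying a point `q` with coordinates in a field extension `κ` of `k`. -/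
def pointIdeal (k : Type*) {κ : Type*} [Field k] [Field κ] [Algebra k κ] {m : ℕ}
    (q : Fin m → κ) : Ideal (MvPolynomial (Fin m) k) :=
  RingHom.ker (MvPolynomial.aeval (R := k) q)

instance (k : Type*) {κ : Type*} [Field k] [Field κ] [Algebra k κ] {m : ℕ} (q : Fin m → κ) :
    (pointIdeal k q).IsPrime :=
  RingHom.ker_isPrime _

/-! ## Pointed lines and contact order -/

/-- A `κ`-point of the flag variety `Φ` of pointed lines in `ℙⁿ`. -/
structure PointedLine (κ : Type*) [Field κ] (n : ℕ) where
  line : Submodule κ (Fin (n + 1) → κ)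
  finrank_line : Module.finrank κ line = 2
  point : Projectivization κ (Fin (n + 1) → κ)
  point_mem : point.submodule ≤ line

/-- The line `L` meets `𝕍(F)` at its marked point `p` to order at least `r`: if `v` spans `p`
and `v`, `w` span `L`, then `F (v + s * w)` is divisible by `s ^ r`. -/
def PointedLine.TangentToOrder {k κ : Type*} [Field k] [Field κ] [Algebra k κ] {n : ℕ}
    (Lp : PointedLine κ n) (F : MvPolynomial (Fin (n + 1)) k) (r : ℕ) : Prop :=
  ∀ v w : Fin (n + 1) → κ, Lp.point.submodule = Submodule.span κ {v} →
    Lp.line = Submodule.span κ {v, w} →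
    (Polynomial.X : κ[X]) ^ r ∣
      MvPolynomial.aeval (fun i => Polynomial.C (v i) + Polynomial.C (w i) * Polynomial.X) F

/-! ## Standard coordinates on the flag variety of pointed lines -/

/-- The index `(I, ℓ)` of a standard chart of `Φ`: `I = {i 0 < i 1}` and `ℓ ∈ {0, 1}`. -/
structure Chart (n : ℕ) where
  i : Fin 2 → Fin (n + 1)
  lt : i 0 < i 1
  l : Fin 2

section Charts

variable {n : ℕ}

/-- The position of `x_{s,j}` in the list `x_{0,0}, x_{1,0}, x_{0,1}, x_{1,1}, …, y`. -/
def xIdx (s : Fin 2) (j : Fin (n - 1)) : Fin (2 * n - 1) :=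
  ⟨2 * j + s, by omega⟩

/-- The position of `y` in the list `x_{0,0}, x_{1,0}, x_{0,1}, x_{1,1}, …, y`. -/
def yIdx [NeZero n] : Fin (2 * n - 1) :=
  ⟨2 * n - 2, by have := NeZero.pos n; omega⟩

/-- The coordinate ring `k[x_{s,j}, y]` of a standard chart `U_{I,ℓ} ≅ 𝔸^{2n-1}` of `Φ`. -/
abbrev ChartRing (k : Type u) [Field k] (n : ℕ) : Type u := MvPolynomial (Fin (2 * n - 1)) k

namespace Chart

variable (C : Chart n)

theorem card_compl : ({C.i 0, C.i 1}ᶜ : Finset (Fin (n + 1))).card = n - 1 := by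
  rw [Finset.card_compl, Finset.card_pair C.lt.ne, Fintype.card_fin]
  omega

/-- The increasing enumeration `c_0 < c_1 < …` of the complement of `I`. -/
def c : Fin (n - 1) ↪o Fin (n + 1) :=
  ({C.i 0, C.i 1}ᶜ : Finset (Fin (n + 1))).orderEmbOfFin C.card_compl

/-- The sign `(-1)^ℓ` in the twisted charts of `ℙ¹`. -/
def sign (B : Type*) [CommRing B] : B := (-1) ^ (C.l : ℕ)

theorem sign_sq (B : Type*) [CommRing B] : C.sign B * C.sign B = 1 := by
  rw [sign, ← mul_pow]; simp

variable {B : Type*} [CommRing B]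

/-- The vector `e_{i_s} + ∑ j, x_{s,j} e_{c_j}` of the basis of the line with coordinates `q`. -/
def frame (q : Fin (2 * n - 1) → B) (s : Fin 2) : Fin (n + 1) → B :=
  Pi.single (C.i s) 1 + ∑ j : Fin (n - 1), Pi.single (C.c j) (q (xIdx s j))

variable [NeZero n]

/-- The local parameter `t = z_{i_{ℓ'}} / z_{i_ℓ}` of the lines at their marked points (`ℓ'` is
the other index). It is related to the standard coordinate `y` by `y = (-1)^ℓ t`. -/
def param (q : Fin (2 * n - 1) → B) : B := C.sign B * q yIdx

/-- The vector spanning the marked point with coordinates `q`, scaled to have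
`i_ℓ`-th entry `1` (and `i_{ℓ'}`-th entry `t`). -/
def markedVector (q : Fin (2 * n - 1) → B) : Fin (n + 1) → B :=
  C.frame q C.l + C.param q • C.frame q C.l.rev

/-- The pointed line lies in `U_{I,ℓ}` and `φ_{I,ℓ}` takes it to `q`. -/
def HasCoordinates {κ : Type*} [Field κ] (Lp : PointedLine κ n) (q : Fin (2 * n - 1) → κ) : Prop :=
  Lp.line = Submodule.span κ (Set.range (C.frame q)) ∧
    Lp.point.submodule = Submodule.span κ {C.markedVector q}

/-- The pullback `β^* F` along `β : Φ → ℙⁿ` on the chart `U_{I,ℓ}`, as a section of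
`𝒪_Φ(d)`, which is trivialized there by `z_{i_ℓ} ^ d`. -/
def pullback {k : Type u} [Field k] (F : MvPolynomial (Fin (n + 1)) k) : ChartRing k n :=
  MvPolynomial.aeval (C.markedVector MvPolynomial.X) F

end Chart

/-! ## The bundle of principal parts -/

/-- The `r`-th principal parts `(A ⊗ A) / I^(r+1)` of an algebra `A` over `R`, where `I` is the
ideal of the diagonal. It is an `A`-module through the first tensor factor; functions are
pulled back along the projection which is given by the second factor. -/
abbrev PrincipalParts (R A : Type*) [CommRing R] [CommRing A] [Algebra R A] (r : ℕ) : Type _ :=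
  (A ⊗[R] A) ⧸ (KaehlerDifferential.ideal R A) ^ (r + 1)


/-- The coordinate ring `k[x_{s,j}]` of the standard chart `U_I` of the Grassmannian of lines,
as a subring of that of `U_{I,ℓ}` through the projection `π : Φ → G`. -/
abbrev baseRing (k : Type u) [Field k] (n : ℕ) [NeZero n] : Subalgebra k (ChartRing k n) := MvPolynomial.supported k {yIdx}ᶜ

/-- The sections over the chart `U_{I,ℓ}` of the bundle `ℰ_{2n-1}` of `(2n-2)`-nd
principal parts of `𝒪_Φ(d)` relative to `π : Φ → G`; here `𝒪_Φ(d)` is trivialized by `z_{i_ℓ} ^ d`. -/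
abbrev ChartBundle (k : Type u) [Field k] (n : ℕ) [NeZero n] : Type u := PrincipalParts (baseRing k n) (ChartRing k n) (2 * n - 2)

namespace Chart

variable [NeZero n] (C : Chart n) (k : Type u) [Field k]

/-- The section `σ_F` of `ℰ_{2n-1}` on the chart `U_{I,ℓ}`: the principal parts of `β^* F`. -/
def sectionσ {k : Type u} [Field k] (F : MvPolynomial (Fin (n + 1)) k) : ChartBundle k n :=
  Ideal.Quotient.mk _ ((1 : ChartRing k n) ⊗ₜ[baseRing k n] C.pullback F)

/-- Taylor expansion in `t` as a homomorphism over `k`: `t ↦ t + s` and `x_{s,j} ↦ x_{s,j}`,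
where `s` is the polynomial variable. As `y = (-1)^ℓ t`, it takes `y` to `y + (-1)^ℓ s`. -/
def taylorAux : ChartRing k n →ₐ[k] (ChartRing k n)[X] :=
  MvPolynomial.aeval fun i => Polynomial.C (MvPolynomial.X i) +
    if i = yIdx then Polynomial.C (C.sign (ChartRing k n)) * Polynomial.X else 0

theorem taylorAux_base (r : baseRing k n) :
    C.taylorAux k (r : ChartRing k n) = Polynomial.C (r : ChartRing k n) := by
  have h : baseRing k n ≤ AlgHom.equalizer (C.taylorAux k)
      (IsScalarTower.toAlgHom k (ChartRing k n) (ChartRing k n)[X]) := by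
    refine AlgHom.adjoin_le_equalizer _ _ ?_
    rintro _ ⟨i, hi, rfl⟩
    have hi' : i ≠ yIdx := hi
    simp [taylorAux, hi']
  exact h r.2

/-- Taylor expansion in the parameter `t`, as a homomorphism over `k[x_{s,j}]`. -/
def taylor : ChartRing k n →ₐ[baseRing k n] (ChartRing k n)[X] :=
  { C.taylorAux k with commutes' := C.taylorAux_base k }

/-- The `a`-th Hasse derivative with respect to `t` on the chart `U_{I,ℓ}`; it is linear over
`k[x_{s,j}]`. -/
def hasseDeriv (a : ℕ) : ChartRing k n →ₗ[baseRing k n] ChartRing k n :=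
  ((Polynomial.lcoeff (ChartRing k n) a).restrictScalars (baseRing k n)) ∘ₗ (C.taylor k).toLinearMap

/-- The local parameter `t` as a function on the chart. -/
def t : ChartRing k n := C.param MvPolynomial.X

theorem taylor_t : C.taylor k (C.t k) = Polynomial.C (C.t k) + Polynomial.X := by
  change C.taylorAux k (C.t k) = _
  have h : Polynomial.C (C.sign (ChartRing k n)) * Polynomial.C (C.sign (ChartRing k n)) = 1 := by
    rw [← Polynomial.C_mul, sign_sq, Polynomial.C_1]
  have h2 : C.taylorAux k (C.sign (ChartRing k n)) = Polynomial.C (C.sign (ChartRing k n)) := by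
    simp [sign]
  rw [t, param, map_mul, h2]
  simp only [taylorAux, MvPolynomial.aeval_X, if_true, Polynomial.C_mul]
  rw [mul_add, ← mul_assoc, h, one_mul]

/-- The defining rule `D_t^{(a)} t^N = binom(N, a) t^(N-a)` (zero if `N < a`). -/
theorem hasseDeriv_t_pow (a N : ℕ) :
    C.hasseDeriv k a (C.t k ^ N) = (N.choose a : ChartRing k n) * C.t k ^ (N - a) := by
  change (C.taylor k (C.t k ^ N)).coeff a = _
  rw [map_pow, taylor_t, add_comm, Polynomial.coeff_X_add_C_pow, mul_comm]

theorem chartRing_hom_ext {S : Type*} [CommRing S] [Algebra (baseRing k n) S]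
    {f g : ChartRing k n →ₐ[baseRing k n] S} (h : f (C.t k) = g (C.t k)) : f = g := by
  have hs : ∀ f : ChartRing k n →ₐ[baseRing k n] S,
      f (MvPolynomial.X yIdx) = C.sign S * f (C.t k) := by
    intro f
    have h2 : f (C.sign (ChartRing k n)) = C.sign S := by simp [sign]
    rw [t, param, map_mul, h2, ← mul_assoc, sign_sq, one_mul]
  apply AlgHom.coe_ringHom_injective
  refine MvPolynomial.ringHom_ext (fun c => ?_) (fun i => ?_)
  · exact (f.commutes (algebraMap k (baseRing k n) c)).trans
      (g.commutes (algebraMap k (baseRing k n) c)).symm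
  · by_cases hi : i = yIdx
    · subst hi
      simp [hs, h]
    · have hm : (MvPolynomial.X i : ChartRing k n) ∈ baseRing k n :=
        Algebra.subset_adjoin ⟨i, hi, rfl⟩
      exact (f.commutes ⟨_, hm⟩).trans (g.commutes ⟨_, hm⟩).symm

/-- The homomorphism `b ⊗ f ↦ b * f(t + s)`. -/
def jetHom : ChartRing k n ⊗[baseRing k n] ChartRing k n →ₐ[ChartRing k n] (ChartRing k n)[X] :=
  Algebra.TensorProduct.lift (Algebra.ofId _ _) (C.taylor k) fun _ _ => Commute.all _ _

theorem jetHom_tmul (b f : ChartRing k n) :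
    C.jetHom k (b ⊗ₜ f) = Polynomial.C b * C.taylor k f := by
  simp [jetHom, Algebra.ofId_apply]

/-- `1 ⊗ t - t ⊗ 1`, the generator of the ideal of the diagonal. -/
def diag : ChartRing k n ⊗[baseRing k n] ChartRing k n :=
  1 ⊗ₜ[baseRing k n] C.t k - C.t k ⊗ₜ[baseRing k n] 1

theorem jetHom_diag : C.jetHom k (C.diag k) = Polynomial.X := by
  simp [jetHom, diag, taylor_t, Algebra.ofId_apply]

/-- The inverse of `jetHom`, `s ↦ 1 ⊗ t - t ⊗ 1`. -/
def jetInv : (ChartRing k n)[X] →ₐ[ChartRing k n] ChartRing k n ⊗[baseRing k n] ChartRing k n :=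
  Polynomial.aeval (C.diag k)

theorem jetInv_comp : (C.jetInv k).comp (C.jetHom k) = AlgHom.id _ _ := by
  refine Algebra.TensorProduct.ext (by ext) ?_
  apply C.chartRing_hom_ext k
  simp [jetHom, jetInv, taylor_t, Algebra.ofId_apply, diag]

theorem jetHom_comp : (C.jetHom k).comp (C.jetInv k) = AlgHom.id _ _ := by
  ext
  simp [jetInv, jetHom_diag]

/-- `jetHom` is an isomorphism. -/
def jetEquiv :
    (ChartRing k n ⊗[baseRing k n] ChartRing k n) ≃ₐ[ChartRing k n] (ChartRing k n)[X] :=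
  AlgEquiv.ofAlgHom (C.jetHom k) (C.jetInv k) (C.jetHom_comp k) (C.jetInv_comp k)

theorem jetEquiv_diag : C.jetEquiv k (C.diag k) = Polynomial.X := C.jetHom_diag k

theorem X_pow_dvd_jetEquiv (N : ℕ) (z : ChartRing k n ⊗[baseRing k n] ChartRing k n) :
    Polynomial.X ^ N ∣ C.jetEquiv k z ↔ z ∈ Ideal.span {C.diag k ^ N} := by
  rw [Ideal.mem_span_singleton, ← jetEquiv_diag, ← map_pow]
  exact map_dvd_iff (C.jetEquiv k)

theorem ideal_eq : KaehlerDifferential.ideal (baseRing k n) (ChartRing k n) =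
    Ideal.span {C.diag k} := by
  ext z
  have h : ((Polynomial.aeval (R := ChartRing k n) (0 : ChartRing k n)).comp
      (C.jetHom k)).restrictScalars (baseRing k n) =
      Algebra.TensorProduct.lmul' (S := ChartRing k n) (baseRing k n) := by
    refine Algebra.TensorProduct.ext ?_ ?_
    · apply C.chartRing_hom_ext k
      change Polynomial.aeval (R := ChartRing k n) 0 (C.jetHom k (C.t k ⊗ₜ 1)) = C.t k * 1
      simp [jetHom_tmul]
    · apply C.chartRing_hom_ext k
      change Polynomial.aeval (R := ChartRing k n) 0 (C.jetHom k (1 ⊗ₜ C.t k)) = 1 * C.t k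
      simp [jetHom_tmul, taylor_t]
  have h2 : (C.jetHom k z).coeff 0 =
      Algebra.TensorProduct.lmul' (S := ChartRing k n) (baseRing k n) z := by
    rw [Polynomial.coeff_zero_eq_aeval_zero]
    exact congrArg (fun f => f z) h
  rw [RingHom.mem_ker, ← pow_one (C.diag k), ← X_pow_dvd_jetEquiv, pow_one, Polynomial.X_dvd_iff]
  exact Eq.congr_left h2.symm

/-- The jet `b ⊗ f ↦ (b * D_t^{(a)} f)_a`, for `a = 0, …, 2n-2`. -/
def jet : ChartRing k n ⊗[baseRing k n] ChartRing k n →ₗ[ChartRing k n]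
    (Fin (2 * n - 1) → ChartRing k n) :=
  LinearMap.pi fun a => Polynomial.lcoeff (ChartRing k n) a ∘ₗ (C.jetHom k).toLinearMap

theorem jet_tmul (b f : ChartRing k n) (a : Fin (2 * n - 1)) :
    C.jet k (b ⊗ₜ f) a = b * C.hasseDeriv k a f := by
  change (C.jetHom k (b ⊗ₜ f)).coeff a = b * (C.taylor k f).coeff a
  simp [jetHom, Algebra.ofId_apply]

theorem jet_surjective : Function.Surjective (C.jet k) := by
  intro v
  refine ⟨C.jetInv k (∑ a : Fin (2 * n - 1), Polynomial.monomial (a : ℕ) (v a)), ?_⟩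
  funext a
  change (C.jetHom k (C.jetInv k _)).coeff a = _
  have := congrArg (fun f => f (∑ a : Fin (2 * n - 1), Polynomial.monomial (a : ℕ) (v a)))
    (C.jetHom_comp k)
  simp only [AlgHom.comp_apply, AlgHom.id_apply] at this
  rw [this, Polynomial.finsetSum_coeff]
  simp [Polynomial.coeff_monomial, Fin.val_inj]

theorem ker_jet : LinearMap.ker (C.jet k) =
    ((KaehlerDifferential.ideal (baseRing k n) (ChartRing k n)) ^ (2 * n - 2 + 1)).restrictScalars
      (ChartRing k n) := by
  ext z
  have hn : 2 * n - 2 + 1 = 2 * n - 1 := by have := NeZero.pos n; omega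
  rw [Submodule.restrictScalars_mem, ideal_eq, Ideal.span_singleton_pow, ← X_pow_dvd_jetEquiv,
    Polynomial.X_pow_dvd_iff, LinearMap.mem_ker, funext_iff, hn]
  exact ⟨fun h d hd => h ⟨d, hd⟩, fun h a => h a a.2⟩

/-- The local trivialization `τ_{I,ℓ}` of `ℰ_{2n-1}` by Hasse derivatives with respect to `t`:
it takes the class of `b ⊗ f` to `(b * f, b * D_t^{(1)} f, …, b * D_t^{(2n-2)} f)`. -/
def trivialization : ChartBundle k n ≃ₗ[ChartRing k n] (Fin (2 * n - 1) → ChartRing k n) :=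
  (Submodule.Quotient.restrictScalarsEquiv (ChartRing k n) _).symm ≪≫ₗ
    (Submodule.quotEquivOfEq _ _ (C.ker_jet k).symm) ≪≫ₗ
      (C.jet k).quotKerEquivOfSurjective (C.jet_surjective k)

theorem trivialization_mk (b f : ChartRing k n) (a : Fin (2 * n - 1)) :
    C.trivialization k (Ideal.Quotient.mk _ (b ⊗ₜ f)) a = b * C.hasseDeriv k a f :=
  C.jet_tmul k b f a

variable {k}

/-- The map `g_{I,ℓ} = τ_{I,ℓ} ∘ σ_F ∘ φ_{I,ℓ}⁻¹ : 𝔸^{2n-1} → 𝔸^{2n-1}`. -/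
def localMap (F : MvPolynomial (Fin (n + 1)) k) : Fin (2 * n - 1) → ChartRing k n :=
  C.trivialization k (C.sectionσ F)

/-- The local ring, at the point of `U_{I,ℓ}` with coordinates `q`, of the zero scheme of `σ_F`. -/
abbrev SectionZeroLocalRing {κ : Type*} [Field κ] [Algebra k κ]
    (F : MvPolynomial (Fin (n + 1)) k) (q : Fin (2 * n - 1) → κ) : Type u :=
  ZeroLocalRing (C.localMap F) (pointIdeal k q)

/-- The bilinear form whose class is the local index of `σ_F` at the point with coordinates `q`. -/
abbrev indexForm {κ : Type*} [Field κ] [Algebra k κ]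
    (F : MvPolynomial (Fin (n + 1)) k) (q : Fin (2 * n - 1) → κ) :
    LinearMap.BilinForm k (C.SectionZeroLocalRing F q) :=
  schejaStorchForm (C.localMap F) (pointIdeal k q)

/-- The local index of `σ_F` at the point of `U_{I,ℓ}` with coordinates `q`, with respect to the
coordinates `φ_{I,ℓ}` and the trivialization `τ_{I,ℓ}`. -/
def localIndex {κ : Type*} [Field κ] [Algebra k κ]
    (F : MvPolynomial (Fin (n + 1)) k) (q : Fin (2 * n - 1) → κ) : GW k :=
  localDegree (C.localMap F) (pointIdeal k q)

/-! ## The Hasse–Wronskian -/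

/-- Restriction of functions on `U_{I,ℓ}` to the line `L` through the point with coordinates `q`,
on which `t` is an affine coordinate. -/
def restrictToLine {κ : Type*} [Field κ] [Algebra k κ] (q : Fin (2 * n - 1) → κ) :
    ChartRing k n →ₐ[k] κ[X] :=
  MvPolynomial.aeval fun i =>
    if i = yIdx then C.sign κ[X] * Polynomial.X else Polynomial.C (q i)

/-- The gradient of `β^* F` with respect to the standard coordinates `(x_{s,j}, y)`, along `L`. -/
def gradientOnLine {κ : Type*} [Field κ] [Algebra k κ]
    (F : MvPolynomial (Fin (n + 1)) k) (q : Fin (2 * n - 1) → κ) (j : Fin (2 * n - 1)) : κ[X] :=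
  C.restrictToLine q (MvPolynomial.pderiv j (C.pullback F))

end Chart

end Charts

/-- The Hasse–Wronskian `det (D_t^{(a)} f_j)` of polynomials `f_0, …, f_{m-1}` in `t`. -/
def hasseWronskian {κ : Type*} [Field κ] {m : ℕ} (f : Fin m → κ[X]) : κ[X] :=
  Matrix.det (Matrix.of fun a j : Fin m => Polynomial.hasseDeriv (a : ℕ) (f j))

/-- `Wr_t(∇ β^* F)(p)`, in the coordinates of the chart and for its parameter `t`. -/
def Chart.wronskianAt {n : ℕ} [NeZero n] (C : Chart n) {k κ : Type*} [Field k] [Field κ]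
    [Algebra k κ] (F : MvPolynomial (Fin (n + 1)) k) (q : Fin (2 * n - 1) → κ) : κ :=
  (hasseWronskian (C.gradientOnLine F q)).eval (C.param q)

end

end HighlyTangent

namespace HighlyTangent

noncomputable section

/-! ## Functionals on `κ ⊗ κ` and the trace -/

section Trace

variable {k κ : Type*} [Field k] [Field κ] [Algebra k κ]

/-! The zero is simple, so everything takes place over the residue field κ. The local ring Q is
Artinian, local and reduced, hence a field, and evaluation at q identifies it with κ because the
coordinates of q generate κ.

In κ ⊗ κ, Cramer's rule shows that Δ is annihilated by the ideal of the diagonal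
(`diffQuotDetAt_comm`), and on the diagonal Δ becomes the Jacobian J of the local map
(`lmul'_diffQuotDetAt`). For elements with this annihilation property, (Tr ⊗ id)(z) is the
restriction of z to the diagonal (`lid_rTensor_trace_of_comm`). As κ/k is separable, each functional
is η = Tr(c · _), and the condition (η ⊗ id)Δ = 1 becomes cJ = 1. The Scheja–Storch form is
therefore Tr⟨1/J⟩, which is isometric to Tr⟨J⟩ through multiplication by c
(`exists_isometry_schejaStorchForm`). That J ≠ 0 is the Jacobian criterion (`jacobianAt_ne_zero`).

Finally J is the Wronskian: Hasse derivatives in t commute with the partial derivatives, so row a of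
the Jacobian matrix at q is the a-th Hasse derivative of the gradient along L, evaluated at t(p)
(`jacobianAt_localMap`). -/

theorem lid_rTensor_trace_eq_trace_comm [FiniteDimensional k κ] (z : κ ⊗[k] κ) :
    TensorProduct.lid k κ (LinearMap.rTensor κ (Algebra.trace k κ) z) =
      Algebra.trace κ (κ ⊗[k] κ) (Algebra.TensorProduct.comm k κ κ z) := by
  induction z with
  | zero => simp
  | add x y hx hy => simp only [map_add, hx, hy]
  | tmul x y =>
    -- Over the left factor, multiplication by y ⊗ x is y times a base change, and base change
    -- preserves traces. The swap is needed because the functional acts on the left factor.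
    have h : Algebra.lmul κ (κ ⊗[k] κ) (y ⊗ₜ[k] x) =
        y • (Algebra.lmul k κ x).baseChange κ := by
      ext
      simp [TensorProduct.smul_tmul']
    rw [Algebra.TensorProduct.comm_tmul, Algebra.trace_apply (R := κ)]
    change _ = LinearMap.trace κ _ (Algebra.lmul κ (κ ⊗[k] κ) (y ⊗ₜ[k] x))
    rw [h, map_smul, LinearMap.trace_baseChange]
    simp only [LinearMap.rTensor_tmul, TensorProduct.lid_tmul, Algebra.trace_apply, smul_eq_mul,
      Algebra.smul_def]
    rw [mul_comm]

/-- The trace functional takes an element of `κ ⊗ κ` annihilated by the ideal of the diagonal to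
its restriction to the diagonal. -/
theorem lid_rTensor_trace_of_comm [FiniteDimensional k κ] {z : κ ⊗[k] κ}
    (hz : ∀ x : κ, (x ⊗ₜ[k] 1) * z = (1 ⊗ₜ[k] x) * z) :
    TensorProduct.lid k κ (LinearMap.rTensor κ (Algebra.trace k κ) z) =
      Algebra.TensorProduct.lmul' (S := κ) k z := by
  rw [lid_rTensor_trace_eq_trace_comm]
  set z' := Algebra.TensorProduct.comm k κ κ z with hz'
  have hm : ∀ x y : κ, Algebra.TensorProduct.lmul'' (S := κ) k (x ⊗ₜ[k] y) = x * y :=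
    fun _ _ => rfl
  have h1 : ∀ x : κ, (1 ⊗ₜ[k] x) * z' = (x ⊗ₜ[k] 1) * z' := fun x => by
    simpa using congrArg (Algebra.TensorProduct.comm k κ κ) (hz x)
  have h2 : ∀ w : κ ⊗[k] κ, z' * w = Algebra.TensorProduct.lmul'' (S := κ) k w • z' := by
    intro w
    induction w with
    | zero => simp
    | add x y hx hy => rw [mul_add, hx, hy, map_add, add_smul]
    | tmul x y =>
      have : x ⊗ₜ[k] y = (x ⊗ₜ[k] (1 : κ)) * ((1 : κ) ⊗ₜ[k] y) := by simp
      rw [hm, this, mul_comm, mul_assoc, h1, ← mul_assoc]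
      simp [Algebra.smul_def, Algebra.TensorProduct.algebraMap_apply]
  have h3 : Algebra.lmul κ (κ ⊗[k] κ) z' =
      (Algebra.TensorProduct.lmul'' (S := κ) k).toLinearMap.smulRight z' :=
    LinearMap.ext h2
  have h4 : ∀ w : κ ⊗[k] κ, Algebra.TensorProduct.lmul'' (S := κ) k
      (Algebra.TensorProduct.comm k κ κ w) = Algebra.TensorProduct.lmul' (S := κ) k w := by
    intro w
    induction w with
    | zero => simp
    | add x y hx hy => simp only [map_add, hx, hy]
    | tmul x y => simp [hm, mul_comm]
  rw [Algebra.trace_apply]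
  change LinearMap.trace κ _ (Algebra.lmul κ (κ ⊗[k] κ) z') = _
  rw [h3, LinearMap.trace_smulRight, hz']
  exact h4 z

/-- Twisting the trace by c replaces z by (c ⊗ 1)z, which is still annihilated by the ideal of the
diagonal. -/
theorem lid_rTensor_trace_mul_of_comm [FiniteDimensional k κ] {z : κ ⊗[k] κ}
    (hz : ∀ x : κ, (x ⊗ₜ[k] 1) * z = (1 ⊗ₜ[k] x) * z) (c : κ) :
    TensorProduct.lid k κ (LinearMap.rTensor κ (Algebra.trace k κ ∘ₗ LinearMap.mulLeft k c) z) =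
      c * Algebra.TensorProduct.lmul' (S := κ) k z := by
  have h : ∀ w : κ ⊗[k] κ,
      LinearMap.rTensor κ (Algebra.trace k κ ∘ₗ LinearMap.mulLeft k c) w =
        LinearMap.rTensor κ (Algebra.trace k κ) ((c ⊗ₜ[k] 1) * w) := by
    intro w
    induction w with
    | zero => simp
    | add x y hx hy => rw [map_add, hx, hy, mul_add, map_add]
    | tmul x y => simp
  rw [h, lid_rTensor_trace_of_comm, map_mul]
  · simp
  · intro x
    rw [mul_left_comm, hz, mul_left_comm]

/-- Separability makes the trace form nondegenerate, so it identifies κ with its dual. -/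
theorem exists_eq_trace_comp_mulLeft [FiniteDimensional k κ] [Algebra.IsSeparable k κ]
    (η : κ →ₗ[k] k) : ∃ c : κ, η = Algebra.trace k κ ∘ₗ LinearMap.mulLeft k c := by
  refine ⟨((Algebra.traceForm k κ).toDual (traceForm_nondegenerate k κ)).symm η, ?_⟩
  ext x
  have := LinearMap.BilinForm.apply_toDual_symm_apply
    (hB := traceForm_nondegenerate k κ) η x
  exact this.symm.trans (Algebra.traceForm_apply k _ x)

end Trace

/-! ## The determinant of difference quotients on the diagonal -/

section DiffQuot

variable {k : Type u} [Field k] {m : ℕ}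

theorem diffQuot_spec (f : MvPolynomial (Fin m) k) :
    f ⊗ₜ[k] 1 - 1 ⊗ₜ[k] f =
      ∑ j, diffQuot f j * (MvPolynomial.X j ⊗ₜ[k] 1 - 1 ⊗ₜ[k] MvPolynomial.X j) :=
  (exists_diffQuot f).choose_spec

/-- On the diagonal the difference quotients become the partial derivatives. -/
theorem lmul'_diffQuot (f : MvPolynomial (Fin m) k) (j : Fin m) :
    Algebra.TensorProduct.lmul' (S := MvPolynomial (Fin m) k) k (diffQuot f j) =
      MvPolynomial.pderiv j f := by
  classical
  -- Differentiate the first factor, then restrict to the diagonal. On a multiple of X_l ⊗ 1 - 1 ⊗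
  -- X_l, the Leibniz term that differentiates the cofactor dies on the diagonal.
  let T : MvPolynomial (Fin m) k ⊗[k] MvPolynomial (Fin m) k →ₗ[k] MvPolynomial (Fin m) k :=
    LinearMap.mul' k _ ∘ₗ LinearMap.rTensor _ (MvPolynomial.pderiv j).toLinearMap
  have hT : ∀ x y, T (x ⊗ₜ y) = MvPolynomial.pderiv j x * y := fun _ _ => rfl
  have h : ∀ (z : MvPolynomial (Fin m) k ⊗[k] MvPolynomial (Fin m) k) (l : Fin m),
      T (z * (MvPolynomial.X l ⊗ₜ[k] 1 - 1 ⊗ₜ[k] MvPolynomial.X l)) =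
        if l = j then Algebra.TensorProduct.lmul' (S := MvPolynomial (Fin m) k) k z else 0 := by
    intro z l
    induction z with
    | zero => simp
    | add x y hx hy => rw [add_mul, map_add, hx, hy, map_add]; split_ifs <;> simp
    | tmul x y =>
      simp only [mul_sub, Algebra.TensorProduct.tmul_mul_tmul, mul_one, map_sub, hT,
        Derivation.leibniz, MvPolynomial.pderiv_X, smul_eq_mul, Pi.single_apply,
        Algebra.TensorProduct.lmul'_apply_tmul]
      split_ifs <;> ring
  have := congrArg T (diffQuot_spec f)
  simpa [map_sum, h, hT] using this.symm

variable {κ : Type u} [Field κ] [Algebra k κ]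

/-- The Jacobian determinant of `g` at the point `q`. -/
def jacobianAt (g : Fin m → MvPolynomial (Fin m) k) (q : Fin m → κ) : κ :=
  Matrix.det (Matrix.of fun i j => MvPolynomial.aeval q (MvPolynomial.pderiv j (g i)))

/-- The determinant of the difference quotients of `g` in `κ ⊗ κ`, at the point `q`. -/
def diffQuotDetAt (g : Fin m → MvPolynomial (Fin m) k) (q : Fin m → κ) : κ ⊗[k] κ :=
  Algebra.TensorProduct.map (MvPolynomial.aeval q) (MvPolynomial.aeval q)
    (Matrix.det (Matrix.of fun i j => diffQuot (g i) j))

theorem lmul'_diffQuotDetAt (g : Fin m → MvPolynomial (Fin m) k) (q : Fin m → κ) :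
    Algebra.TensorProduct.lmul' (S := κ) k (diffQuotDetAt g q) = jacobianAt g q := by
  have h : (Algebra.TensorProduct.lmul' (S := κ) k).comp
      (Algebra.TensorProduct.map (MvPolynomial.aeval q) (MvPolynomial.aeval q)) =
      (MvPolynomial.aeval q).comp
        (Algebra.TensorProduct.lmul' (S := MvPolynomial (Fin m) k) k) := by
    ext <;> simp
  have h2 := DFunLike.congr_fun h (Matrix.det (Matrix.of fun i j => diffQuot (g i) j))
  refine h2.trans ?_
  rw [AlgHom.comp_apply, AlgHom.map_det, AlgHom.map_det, jacobianAt]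
  congr 1
  ext i j
  simp [lmul'_diffQuot]

/-- Since g vanishes at q, the matrix of difference quotients kills the vector of all q_j ⊗ 1 - 1 ⊗
q_j; multiplying by the adjugate, so does its determinant. The x with the asserted property form a
subalgebra, so the generators q_j suffice. -/
theorem diffQuotDetAt_comm {g : Fin m → MvPolynomial (Fin m) k} {q : Fin m → κ}
    (hg : ∀ i, MvPolynomial.aeval q (g i) = 0) (hκ : Algebra.adjoin k (Set.range q) = ⊤) (x : κ) :
    (x ⊗ₜ[k] 1) * diffQuotDetAt g q = (1 ⊗ₜ[k] x) * diffQuotDetAt g q := by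
  have hX : ∀ j, (q j ⊗ₜ[k] 1 - 1 ⊗ₜ[k] q j) * diffQuotDetAt g q = 0 := by
    set φ := Algebra.TensorProduct.map (MvPolynomial.aeval (R := k) q)
      (MvPolynomial.aeval (R := k) q) with hφ
    let M : Matrix (Fin m) (Fin m) (κ ⊗[k] κ) := Matrix.of fun i j => φ (diffQuot (g i) j)
    let w : Fin m → κ ⊗[k] κ := fun j => q j ⊗ₜ[k] 1 - 1 ⊗ₜ[k] q j
    have hM : M.mulVec w = 0 := by
      ext i
      have := congrArg φ (diffQuot_spec (g i))
      simp only [hφ, map_sub, map_sum, map_mul, Algebra.TensorProduct.map_tmul, hg, map_one,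
        MvPolynomial.aeval_X, TensorProduct.zero_tmul, TensorProduct.tmul_zero, sub_zero] at this
      exact this.symm
    have hdet : diffQuotDetAt g q = M.det := by
      rw [diffQuotDetAt, AlgHom.map_det]
      rfl
    have := congrArg (M.adjugate.mulVec) hM
    rw [Matrix.mulVec_mulVec, Matrix.adjugate_mul, Matrix.smul_mulVec, Matrix.one_mulVec,
      Matrix.mulVec_zero] at this
    intro j
    rw [mul_comm, hdet]
    exact congrFun this j
  have hx : x ∈ Algebra.adjoin k (Set.range q) := hκ ▸ Algebra.mem_top
  induction hx using Algebra.adjoin_induction with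
  | mem x hx =>
    obtain ⟨j, rfl⟩ := hx
    rw [← sub_eq_zero, ← sub_mul, hX]
  | algebraMap r =>
    congr 1
    rw [Algebra.algebraMap_eq_smul_one, TensorProduct.smul_tmul]
  | add x y _ _ hx hy => rw [TensorProduct.add_tmul, TensorProduct.tmul_add, add_mul, add_mul, hx, hy]
  | mul x y _ _ hx hy =>
    have h1 : (x * y) ⊗ₜ[k] (1 : κ) = (x ⊗ₜ[k] (1 : κ)) * (y ⊗ₜ[k] 1) := by simp
    have h2 : (1 : κ) ⊗ₜ[k] (x * y) = (1 ⊗ₜ[k] x) * ((1 : κ) ⊗ₜ[k] y) := by simp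
    rw [h1, h2, mul_assoc, hy, mul_left_comm, hx]
    ring

end DiffQuot

/-! ## Simple zeros -/

section SimpleZero

variable {k κ : Type u} [Field k] [Field κ] [Algebra k κ] {m : ℕ}
  {g : Fin m → MvPolynomial (Fin m) k} {q : Fin m → κ}

/-- Evaluation at a zero `q` of `g`, on the local ring of the zero scheme of `g` at `q`. -/
def evalZeroLocalRing (hg : ∀ i, MvPolynomial.aeval q (g i) = 0) :
    ZeroLocalRing g (pointIdeal k q) →ₐ[k] κ :=
  Ideal.Quotient.liftₐ ((Ideal.span (Set.range g)).map
      (algebraMap (MvPolynomial (Fin m) k) (Localization.AtPrime (pointIdeal k q))))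
    (IsLocalization.liftAlgHom (M := (pointIdeal k q).primeCompl)
      (f := MvPolynomial.aeval (R := k) q) fun y => isUnit_iff_ne_zero.mpr y.2)
    (by
      intro a ha
      rw [← RingHom.mem_ker]
      refine (Ideal.map_le_iff_le_comap.mpr (Ideal.span_le.mpr ?_)) ha
      rintro _ ⟨i, rfl⟩
      simp [RingHom.mem_ker, hg])

theorem evalZeroLocalRing_toZeroLocalRing (hg : ∀ i, MvPolynomial.aeval q (g i) = 0)
    (f : MvPolynomial (Fin m) k) :
    evalZeroLocalRing hg (toZeroLocalRing g (pointIdeal k q) f) = MvPolynomial.aeval q f := by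
  change IsLocalization.liftAlgHom (M := (pointIdeal k q).primeCompl)
      (f := MvPolynomial.aeval (R := k) q) _ (algebraMap _ _ f) = _
  simp

theorem isField_zeroLocalRing (hg : ∀ i, MvPolynomial.aeval q (g i) = 0)
    [Module.Finite k (ZeroLocalRing g (pointIdeal k q))]
    [IsReduced (ZeroLocalRing g (pointIdeal k q))] :
    IsField (ZeroLocalRing g (pointIdeal k q)) := by
  have : Nontrivial (ZeroLocalRing g (pointIdeal k q)) :=
    (evalZeroLocalRing hg).toRingHom.domain_nontrivial
  have : IsLocalRing (ZeroLocalRing g (pointIdeal k q)) :=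
    IsLocalRing.of_surjective' (R := Localization.AtPrime (pointIdeal k q))
      (Ideal.Quotient.mk ((Ideal.span (Set.range g)).map
        (algebraMap (MvPolynomial (Fin m) k) (Localization.AtPrime (pointIdeal k q)))))
      Ideal.Quotient.mk_surjective
  have : IsArtinianRing (ZeroLocalRing g (pointIdeal k q)) := IsArtinianRing.of_finite k _
  exact IsArtinianRing.isField_of_isReduced_of_isLocalRing _

theorem aeval_surjective_of_adjoin_range_eq_top (hκ : Algebra.adjoin k (Set.range q) = ⊤) :
    Function.Surjective (MvPolynomial.aeval (R := k) q) := by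
  rw [← AlgHom.range_eq_top, ← Algebra.adjoin_range_eq_range_aeval, hκ]

theorem evalZeroLocalRing_bijective (hg : ∀ i, MvPolynomial.aeval q (g i) = 0)
    (hκ : Algebra.adjoin k (Set.range q) = ⊤)
    [Module.Finite k (ZeroLocalRing g (pointIdeal k q))]
    [IsReduced (ZeroLocalRing g (pointIdeal k q))] :
    Function.Bijective (evalZeroLocalRing hg) := by
  constructor
  · let _ := (isField_zeroLocalRing hg).toField
    exact (evalZeroLocalRing hg).toRingHom.injective
  · intro x
    obtain ⟨f, rfl⟩ := aeval_surjective_of_adjoin_range_eq_top hκ x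
    exact ⟨_, evalZeroLocalRing_toZeroLocalRing hg f⟩

/-- Injectivity of evaluation on the local ring, with denominators cleared. -/
theorem exists_mul_mem_span_of_aeval_eq_zero (hg : ∀ i, MvPolynomial.aeval q (g i) = 0)
    (hinj : Function.Injective (evalZeroLocalRing hg)) {f : MvPolynomial (Fin m) k}
    (hf : MvPolynomial.aeval q f = 0) :
    ∃ s : MvPolynomial (Fin m) k, MvPolynomial.aeval q s ≠ 0 ∧
      s * f ∈ Ideal.span (Set.range g) := by
  have h0 : toZeroLocalRing g (pointIdeal k q) f = 0 := hinj <| by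
    rw [evalZeroLocalRing_toZeroLocalRing, hf, map_zero]
  have h1 : algebraMap _ (Localization.AtPrime (pointIdeal k q)) f ∈
      (Ideal.span (Set.range g)).map (algebraMap (MvPolynomial (Fin m) k) _) :=
    Ideal.Quotient.eq_zero_iff_mem.mp h0
  obtain ⟨s, hs, h⟩ := (IsLocalization.algebraMap_mem_map_algebraMap_iff
    (pointIdeal k q).primeCompl _ _ f).mp h1
  exact ⟨s, hs, h⟩

/-- A kernel vector v of the Jacobian matrix gives the derivation D along v at q, which kills the
ideal of g. At a simple zero this ideal is locally the whole ideal of the point, so D would descend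
to a k-derivation of κ, and separability leaves only the zero one. -/
theorem jacobianAt_ne_zero [Algebra.IsSeparable k κ]
    (hg : ∀ i, MvPolynomial.aeval q (g i) = 0)
    (hinj : Function.Injective (evalZeroLocalRing hg)) : jacobianAt g q ≠ 0 := by
  intro hJ
  obtain ⟨v, hv, hJv⟩ := Matrix.exists_mulVec_eq_zero_iff.mpr hJ
  let D : MvPolynomial (Fin m) k → κ := fun f =>
    ∑ j, MvPolynomial.aeval q (MvPolynomial.pderiv j f) * v j
  have hadd : ∀ a b, D (a + b) = D a + D b := fun a b => by
    simp only [D, map_add, add_mul, Finset.sum_add_distrib]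
  have hmul : ∀ a b, D (a * b) = MvPolynomial.aeval q a * D b + MvPolynomial.aeval q b * D a := by
    intro a b
    simp only [D, Derivation.leibniz, smul_eq_mul, map_add, map_mul, add_mul,
      Finset.sum_add_distrib, Finset.mul_sum, mul_assoc]
  -- The two vanishings go together: D(ax) = a(q) D(x) + x(q) D(a).
  have hspan : ∀ f ∈ Ideal.span (Set.range g), MvPolynomial.aeval q f = 0 ∧ D f = 0 := by
    intro f hf
    induction hf using Submodule.span_induction with
    | mem x hx =>
      obtain ⟨i, rfl⟩ := hx
      exact ⟨hg i, congrFun hJv i⟩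
    | zero => simp [D]
    | add x y _ _ hx hy => simp [hadd, hx, hy]
    | smul a x _ hx => simp [hmul, hx]
  have hker : ∀ f, MvPolynomial.aeval q f = 0 → D f = 0 := by
    intro f hf
    obtain ⟨s, hs, hsf⟩ := exists_mul_mem_span_of_aeval_eq_zero hg hinj hf
    have := (hspan _ hsf).2
    rw [hmul, hf, zero_mul, add_zero] at this
    exact (mul_eq_zero.mp this).resolve_left hs
  apply hv
  ext j
  -- The minimal polynomial μ of q_j, taken in the variable X_j, vanishes at q, and D sends it to
  -- μ'(q_j) v_j with μ'(q_j) ≠ 0.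
  have h1 := hker (Polynomial.aeval (MvPolynomial.X j) (minpoly k (q j))) <| by
    rw [← Polynomial.aeval_algHom_apply, MvPolynomial.aeval_X, minpoly.aeval]
  have h2 : D (Polynomial.aeval (MvPolynomial.X j) (minpoly k (q j))) =
      Polynomial.aeval (q j) (Polynomial.derivative (minpoly k (q j))) * v j := by
    simp only [D, Derivation.map_aeval, MvPolynomial.pderiv_X, smul_eq_mul, map_mul,
      ← Polynomial.aeval_algHom_apply, MvPolynomial.aeval_X]
    rw [Finset.sum_eq_single j]
    · simp
    · intro b _ hb
      simp [hb.symm]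
    · simp
  exact (mul_eq_zero.mp (h2.symm.trans h1)).resolve_left
    ((Algebra.IsSeparable.isSeparable k (q j)).aeval_derivative_ne_zero (minpoly.aeval _ _))

theorem map_lid_rTensor {Q : Type*} [CommRing Q] [Algebra k Q] (e : Q ≃ₐ[k] κ) (η : Q →ₗ[k] k)
    (z : Q ⊗[k] Q) :
    e (TensorProduct.lid k Q (LinearMap.rTensor Q η z)) =
      TensorProduct.lid k κ (LinearMap.rTensor κ (η ∘ₗ e.symm.toLinearMap)
        (Algebra.TensorProduct.map e.toAlgHom e.toAlgHom z)) := by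
  induction z with
  | zero => simp
  | add x y hx hy => simp only [map_add, hx, hy]
  | tmul x y => simp

theorem map_schejaStorchElement (hg : ∀ i, MvPolynomial.aeval q (g i) = 0) :
    Algebra.TensorProduct.map (evalZeroLocalRing hg) (evalZeroLocalRing hg)
      (schejaStorchElement g (pointIdeal k q)) = diffQuotDetAt g q := by
  have h : (evalZeroLocalRing hg).comp (toZeroLocalRing g (pointIdeal k q)) =
      MvPolynomial.aeval q :=
    AlgHom.ext (evalZeroLocalRing_toZeroLocalRing hg)
  rw [schejaStorchElement, ← AlgHom.comp_apply, ← Algebra.TensorProduct.map_comp, h]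
  rfl

theorem functionalForm_apply {Q : Type*} [CommRing Q] [Algebra k Q] (η : Q →ₗ[k] k) (x y : Q) :
    functionalForm η x y = η (x * y) := rfl

theorem traceForm_isSymm (a : κ) : (traceForm k a).IsSymm :=
  ⟨fun x y => by simp [traceForm, functionalForm_apply, mul_comm]⟩

theorem traceForm_nondegenerate_of_ne_zero [FiniteDimensional k κ] [Algebra.IsSeparable k κ]
    {a : κ} (ha : a ≠ 0) : (traceForm k a).Nondegenerate := by
  have h : ∀ x : κ, (∀ y, Algebra.trace k κ (a * (x * y)) = 0) → x = 0 := by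
    intro x hx
    have := (traceForm_nondegenerate k κ).1 (a * x) fun y => by
      simpa [Algebra.traceForm_apply, mul_assoc] using hx y
    exact (mul_eq_zero.mp this).resolve_left ha
  exact ⟨fun x hx => h x hx, fun x hx => h x fun y => by rw [mul_comm x y]; exact hx y⟩

/-- Isometric bilinear forms have the same class in `GW(k)`. -/
theorem gwClass_eq_of_isometry {V W : Type u} [AddCommGroup V] [Module k V] [AddCommGroup W]
    [Module k W] [FiniteDimensional k V] [FiniteDimensional k W]
    {B : LinearMap.BilinForm k V} {B' : LinearMap.BilinForm k W}
    (hB : B.IsSymm ∧ B.Nondegenerate) (hB' : B'.IsSymm ∧ B'.Nondegenerate)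
    (e : V ≃ₗ[k] W) (he : ∀ x y, B x y = B' (e x) (e y)) : gwClass B = gwClass B' := by
  rw [gwClass, gwClass, dif_pos ⟨‹_›, hB⟩, dif_pos ⟨‹_›, hB'⟩, QuotientAddGroup.eq_iff_sub_mem]
  exact AddSubgroup.subset_closure (Or.inl ⟨_, _, ⟨e, he⟩, rfl⟩)

/-- At a zero with reduced local ring and separable residue field, the Scheja–Storch form is
isometric to the trace form of the Jacobian. -/
theorem exists_isometry_schejaStorchForm [FiniteDimensional k κ] [Algebra.IsSeparable k κ]
    (hg : ∀ i, MvPolynomial.aeval q (g i) = 0) (hκ : Algebra.adjoin k (Set.range q) = ⊤)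
    (hbij : Function.Bijective (evalZeroLocalRing hg)) :
    ∃ e : ZeroLocalRing g (pointIdeal k q) ≃ₗ[k] κ, ∀ x y,
      schejaStorchForm g (pointIdeal k q) x y = traceForm k (jacobianAt g q) (e x) (e y) := by
  let ε : ZeroLocalRing g (pointIdeal k q) ≃ₐ[k] κ := AlgEquiv.ofBijective _ hbij
  have hJ := jacobianAt_ne_zero hg hbij.1
  have hiff : ∀ (η : ZeroLocalRing g (pointIdeal k q) →ₗ[k] k) (c : κ),
      η ∘ₗ ε.symm.toLinearMap = Algebra.trace k κ ∘ₗ LinearMap.mulLeft k c →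
      (IsSchejaStorchFunctional g (pointIdeal k q) η ↔ c * jacobianAt g q = 1) := by
    intro η c hc
    rw [IsSchejaStorchFunctional, ← ε.injective.eq_iff, map_lid_rTensor, map_one, hc]
    have : Algebra.TensorProduct.map ε.toAlgHom ε.toAlgHom
        (schejaStorchElement g (pointIdeal k q)) = diffQuotDetAt g q :=
      map_schejaStorchElement hg
    rw [this, lid_rTensor_trace_mul_of_comm (diffQuotDetAt_comm hg hκ), lmul'_diffQuotDetAt]
  have hex : ∃ η, IsSchejaStorchFunctional g (pointIdeal k q) η := by
    refine ⟨(Algebra.trace k κ ∘ₗ LinearMap.mulLeft k (jacobianAt g q)⁻¹) ∘ₗ ε.toLinearMap,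
      (hiff _ (jacobianAt g q)⁻¹ ?_).mpr (inv_mul_cancel₀ hJ)⟩
    ext x
    simp
  have hη : IsSchejaStorchFunctional g (pointIdeal k q)
      (schejaStorchFunctional g (pointIdeal k q)) := by
    rw [schejaStorchFunctional, dif_pos hex]
    exact hex.choose_spec
  -- The functional is an unspecified choice, but its trace representation forces c to be the
  -- inverse of the Jacobian.
  obtain ⟨c, hc⟩ := exists_eq_trace_comp_mulLeft
    (schejaStorchFunctional g (pointIdeal k q) ∘ₗ ε.symm.toLinearMap)
  have hcJ := (hiff _ c hc).mp hη
  have hc0 : c ≠ 0 := left_ne_zero_of_mul_eq_one hcJ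
  -- Scaling by c turns Tr⟨c⟩ into Tr⟨J⟩, since J(cx)(cy) = cxy when cJ = 1.
  refine ⟨ε.toLinearEquiv.trans (LinearEquiv.smulOfNeZero κ κ c hc0 |>.restrictScalars k), ?_⟩
  intro x y
  have h := DFunLike.congr_fun hc (ε (x * y))
  simp only [LinearMap.comp_apply, AlgEquiv.toLinearMap_apply, AlgEquiv.symm_apply_apply,
    LinearMap.mulLeft_apply] at h
  rw [schejaStorchForm, functionalForm_apply, h, traceForm, functionalForm_apply]
  change _ = Algebra.trace k κ (jacobianAt g q * ((c * ε x) * (c * ε y)))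
  congr 1
  rw [map_mul]
  linear_combination (-(c * ε x * ε y)) * hcJ

/-- Nondegeneracy is transported along the isometry before classes are compared, because `gwClass`
is 0 by default on degenerate forms. -/
theorem schejaStorchForm_nondegenerate_and_localDegree_eq [FiniteDimensional k κ]
    [Algebra.IsSeparable k κ]
    (hg : ∀ i, MvPolynomial.aeval q (g i) = 0) (hκ : Algebra.adjoin k (Set.range q) = ⊤)
    [Module.Finite k (ZeroLocalRing g (pointIdeal k q))]
    [IsReduced (ZeroLocalRing g (pointIdeal k q))] :
    (schejaStorchForm g (pointIdeal k q)).Nondegenerate ∧ jacobianAt g q ≠ 0 ∧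
      localDegree g (pointIdeal k q) = gwClass (traceForm k (jacobianAt g q)) := by
  have hbij := evalZeroLocalRing_bijective hg hκ
  have hJ := jacobianAt_ne_zero hg hbij.1
  obtain ⟨e, he⟩ := exists_isometry_schejaStorchForm hg hκ hbij
  have hn := traceForm_nondegenerate_of_ne_zero (k := k) hJ
  have hnd : (schejaStorchForm g (pointIdeal k q)).Nondegenerate := by
    constructor
    · intro x hx
      refine e.map_eq_zero_iff.mp (hn.1 _ fun y => ?_)
      simpa [he] using hx (e.symm y)
    · intro x hx
      refine e.map_eq_zero_iff.mp (hn.2 _ fun y => ?_)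
      simpa [he] using hx (e.symm y)
  have hsymm : (schejaStorchForm g (pointIdeal k q)).IsSymm :=
    ⟨fun x y => by simp [schejaStorchForm, functionalForm_apply, mul_comm]⟩
  exact ⟨hnd, hJ, gwClass_eq_of_isometry ⟨hsymm, hnd⟩ ⟨traceForm_isSymm _, hn⟩ e he⟩

end SimpleZero

/-! ## The Wronskian -/

namespace Chart

variable {n : ℕ} [NeZero n] (C : Chart n) {k κ : Type u} [Field k] [Field κ] [Algebra k κ]

theorem xIdx_ne_yIdx (s : Fin 2) (j : Fin (n - 1)) : xIdx s j ≠ yIdx (n := n) := by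
  have := s.2
  have := j.2
  simp only [xIdx, yIdx, ne_eq, Fin.mk.injEq]
  omega

theorem localMap_apply (F : MvPolynomial (Fin (n + 1)) k) (a : Fin (2 * n - 1)) :
    C.localMap F a = C.hasseDeriv k a (C.pullback F) :=
  (C.trivialization_mk k 1 _ a).trans (one_mul _)

theorem hasseDeriv_apply (a : ℕ) (f : ChartRing k n) :
    C.hasseDeriv k a f = (C.taylorAux k f).coeff a := rfl

/-- Hasse derivatives with respect to `t` commute with partial derivatives. -/
theorem pderiv_hasseDeriv (j : Fin (2 * n - 1)) (a : ℕ) (f : ChartRing k n) :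
    MvPolynomial.pderiv j (C.hasseDeriv k a f) = C.hasseDeriv k a (MvPolynomial.pderiv j f) := by
  simp only [hasseDeriv_apply]
  have hs : MvPolynomial.pderiv j (C.sign (ChartRing k n)) = 0 := by
    have : C.sign (ChartRing k n) = MvPolynomial.C (C.sign k) := by simp [sign]
    rw [this, MvPolynomial.pderiv_C]
  have hX : ∀ i, C.taylorAux k (MvPolynomial.X i) = Polynomial.C (MvPolynomial.X i) +
      if i = yIdx then Polynomial.C (C.sign (ChartRing k n)) * Polynomial.X else 0 := fun i => by
    simp [taylorAux]
  induction f using MvPolynomial.induction_on generalizing a with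
  | C c =>
    have : C.taylorAux k (MvPolynomial.C c) = Polynomial.C (MvPolynomial.C c) :=
      (C.taylorAux k).commutes c
    rw [this, MvPolynomial.pderiv_C, map_zero, Polynomial.coeff_C, Polynomial.coeff_zero]
    split_ifs <;> simp
  | add f g hf hg => simp only [map_add, Polynomial.coeff_add, hf, hg]
  | mul_X f i hf =>
    -- The partial derivative of a variable is 0 or 1, so Taylor expansion fixes it.
    have hδ : C.taylorAux k (f * MvPolynomial.pderiv j (MvPolynomial.X i)) =
        C.taylorAux k f * Polynomial.C (MvPolynomial.pderiv j (MvPolynomial.X i)) := by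
      rw [map_mul, MvPolynomial.pderiv_X, Pi.single_apply]
      split_ifs <;> simp
    rw [Derivation.leibniz, map_add, smul_eq_mul, smul_eq_mul, hδ, map_mul, map_mul, hX]
    split_ifs
    -- Only y is moved by the expansion. Its extra factor s shifts coefficients by one, so
    -- coefficient a + 1 calls on the induction hypothesis at a as well; this is why a is
    -- generalized.
    · cases a with
      | zero => simp [hf, mul_add, Derivation.leibniz]
      | succ a =>
        have hsX : ∀ p : (ChartRing k n)[X],
            (Polynomial.C (C.sign (ChartRing k n)) * Polynomial.X * p).coeff (a + 1) =
              C.sign (ChartRing k n) * p.coeff a := fun p => by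
          rw [mul_assoc, Polynomial.coeff_C_mul, Polynomial.coeff_X_mul]
        simp [hf, hs, hsX, mul_add, add_mul, Derivation.leibniz, ← mul_assoc]
        ring
    · simp [hf, Derivation.leibniz]

/-- Taylor expansion in `t` along the line, at the point with coordinates `q`. -/
def taylorAt (q : Fin (2 * n - 1) → κ) : ChartRing k n →ₐ[k] κ[X] :=
  (Polynomial.mapAlgHom (MvPolynomial.aeval q)).comp (C.taylorAux k)

theorem coeff_taylorAt (q : Fin (2 * n - 1) → κ) (f : ChartRing k n) (a : ℕ) :
    (C.taylorAt q f).coeff a = MvPolynomial.aeval q (C.hasseDeriv k a f) := by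
  simp [taylorAt, hasseDeriv_apply]

theorem taylorAt_X (q : Fin (2 * n - 1) → κ) (i : Fin (2 * n - 1)) :
    C.taylorAt (k := k) q (MvPolynomial.X i) = Polynomial.C (q i) +
      if i = yIdx then Polynomial.C (C.sign κ) * Polynomial.X else 0 := by
  simp only [taylorAt, taylorAux, AlgHom.comp_apply, MvPolynomial.aeval_X]
  split_ifs <;> simp [sign]

/-- Both sides are k-algebra maps, so the variables decide. For y, replacing t by t(p) + s in (-1)^ℓ
t gives q_y + (-1)^ℓ s, as the sign squares to 1. -/
theorem taylorAt_eq (q : Fin (2 * n - 1) → κ) (f : ChartRing k n) :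
    C.taylorAt q f = Polynomial.taylor (C.param q) (C.restrictToLine q f) := by
  have h : C.taylorAt q = ((Polynomial.taylorAlgHom (C.param q)).restrictScalars k).comp
      (C.restrictToLine (k := k) q) := by
    refine MvPolynomial.algHom_ext fun i => ?_
    rw [taylorAt_X]
    by_cases hi : i = yIdx
    · subst hi
      have hs : C.sign κ[X] = Polynomial.C (C.sign κ) := by simp [sign]
      have h2 : Polynomial.C (C.sign κ) * Polynomial.C (C.sign κ) = (1 : κ[X]) := by
        rw [← Polynomial.C_mul, sign_sq, Polynomial.C_1]
      simp [restrictToLine, param, hs]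
      linear_combination (-Polynomial.C (q yIdx)) * h2
    · simp [restrictToLine, hi]
  exact DFunLike.congr_fun h f

theorem eval_hasseDeriv_restrictToLine (q : Fin (2 * n - 1) → κ) (f : ChartRing k n) (a : ℕ) :
    (Polynomial.hasseDeriv a (C.restrictToLine q f)).eval (C.param q) =
      MvPolynomial.aeval q (C.hasseDeriv k a f) := by
  rw [← coeff_taylorAt, taylorAt_eq, Polynomial.taylor_coeff]

/-- The Jacobian of the local map is the Wronskian of the gradient. -/
theorem jacobianAt_localMap (F : MvPolynomial (Fin (n + 1)) k) (q : Fin (2 * n - 1) → κ) :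
    jacobianAt (C.localMap F) q = C.wronskianAt F q := by
  rw [wronskianAt, hasseWronskian, ← Polynomial.coe_evalRingHom, RingHom.map_det, jacobianAt]
  congr 1
  ext a j
  simp [gradientOnLine, eval_hasseDeriv_restrictToLine, localMap_apply, pderiv_hasseDeriv]

theorem taylorAt_frame (q : Fin (2 * n - 1) → κ) (s : Fin 2) (i : Fin (n + 1)) :
    C.taylorAt (k := k) q (C.frame MvPolynomial.X s i) = Polynomial.C (C.frame q s i) := by
  simp [frame, Pi.single_apply, apply_ite (C.taylorAt (k := k) q), taylorAt_X, xIdx_ne_yIdx,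
    apply_ite Polynomial.C]

/-- The frame does not involve y, so shifting t by s slides the marked vector along the line by s
times the other frame vector. Hence the Taylor coefficients defining σ_F are those in the tangency
condition. -/
theorem taylorAt_pullback (F : MvPolynomial (Fin (n + 1)) k) (q : Fin (2 * n - 1) → κ) :
    C.taylorAt q (C.pullback F) = MvPolynomial.aeval (fun i => Polynomial.C (C.markedVector q i) +
      Polynomial.C (C.frame q C.l.rev i) * Polynomial.X) F := by
  rw [pullback, ← AlgHom.comp_apply, MvPolynomial.comp_aeval]
  congr 2
  ext1 i
  have hs : C.taylorAt (k := k) q (C.sign _) = Polynomial.C (C.sign κ) := by simp [sign]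
  have h2 : Polynomial.C (C.sign κ) * Polynomial.C (C.sign κ) = (1 : κ[X]) := by
    rw [← Polynomial.C_mul, sign_sq, Polynomial.C_1]
  simp only [markedVector, param, Pi.add_apply, Pi.smul_apply, smul_eq_mul, map_add, map_mul,
    taylorAt_frame, taylorAt_X, hs, if_true]
  linear_combination (Polynomial.X * Polynomial.C (C.frame q C.l.rev i)) * h2

theorem span_markedVector (q : Fin (2 * n - 1) → κ) :
    Submodule.span κ (Set.range (C.frame q)) =
      Submodule.span κ {C.markedVector q, C.frame q C.l.rev} := by
  have hr : Set.range (C.frame q) = {C.frame q C.l, C.frame q C.l.rev} := by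
    ext x
    have : C.l = 0 ∨ C.l = 1 := by omega
    rcases this with h | h <;> simp [h, Fin.exists_fin_two, eq_comm, or_comm]
  rw [hr]
  refine le_antisymm (Submodule.span_le.mpr ?_) (Submodule.span_le.mpr ?_) <;>
    rw [Set.insert_subset_iff, Set.singleton_subset_iff] <;>
    simp only [SetLike.mem_coe, Submodule.mem_span_pair]
  · exact ⟨⟨1, -C.param q, by simp [markedVector]⟩, ⟨0, 1, by simp⟩⟩
  · exact ⟨⟨1, C.param q, by simp [markedVector]⟩, ⟨0, 1, by simp⟩⟩

theorem aeval_localMap_eq_zero {F : MvPolynomial (Fin (n + 1)) k} {Lp : PointedLine κ n}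
    (hLp : Lp.TangentToOrder F (2 * n - 1)) {q : Fin (2 * n - 1) → κ}
    (hq : C.HasCoordinates Lp q) (a : Fin (2 * n - 1)) :
    MvPolynomial.aeval q (C.localMap F a) = 0 := by
  -- Tangency is tested on the basis of L given by the marked vector and the other frame vector.
  have h := hLp _ (C.frame q C.l.rev) hq.2 (hq.1.trans (C.span_markedVector q))
  rw [← taylorAt_pullback, Polynomial.X_pow_dvd_iff] at h
  rw [localMap_apply, ← coeff_taylorAt]
  exact h a a.2

end Chart

end

end HighlyTangent

/-- A closed point of Φ is presented by a κ-point whose chart coordinates generate κ over k; `hκ`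
thus makes κ exactly the residue field rather than an extension of it. -/
theorem mainTheorem1 {k κ : Type u} [Field k] [Field κ] [Algebra k κ]
    [FiniteDimensional k κ] [Algebra.IsSeparable k κ]
    (n : ℕ) [NeZero n] (d : ℕ) (hd : 2 * n - 1 ≤ d)
    (F : MvPolynomial (Fin (n + 1)) k) (hF : F.IsHomogeneous d)
    (Lp : HighlyTangent.PointedLine κ n) (hLp : Lp.TangentToOrder F (2 * n - 1))
    (C : HighlyTangent.Chart n) (q : Fin (2 * n - 1) → κ) (hq : C.HasCoordinates Lp q)
    (hκ : Algebra.adjoin k (Set.range q) = ⊤)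
    (hisol : Module.Finite k (C.SectionZeroLocalRing F q))
    (hred : Algebra.IsGeometricallyReduced k (C.SectionZeroLocalRing F q)) :
    (C.indexForm F q).Nondegenerate ∧
    C.wronskianAt F q ≠ 0 ∧
    C.localIndex F q =
      HighlyTangent.gwClass (HighlyTangent.traceForm k (C.wronskianAt F q)) := by
  have := Algebra.isReduced_of_isGeometricallyReduced (k := k) (A := C.SectionZeroLocalRing F q)
  have h := HighlyTangent.schejaStorchForm_nondegenerate_and_localDegree_eq
    (C.aeval_localMap_eq_zero hLp hq) hκ
  rwa [C.jacobianAt_localMap] at h
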